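/- A digraph $D$ consists of a vertex set $D$ and an edge set $E(D)\subseteq D\times D$; all digraphs considered are without loops. It is connected if its underlying undirected graph is connected, and locally finite if every vertex has finitely many out-neighbours and finitely many in-neighbours. For an integer $s\ge 0$, an $s$-arc from $u$ to $v$ is a sequence $u=u_0,u_1,\dots,u_s=v$ of vertices with $(u_i,u_{i+1})\in E(D)$ for $0\le i<s$ and $u_{i-1}\ne u_{i+1}$ for $0<i<s$. For a set $X$ of vertices, $\mathrm{desc}(X)$ is the set of all vertices $v$ for which there is an $s$-arc from some $x\in X$ to $v$ for some $s\ge 0$. The digraph $D$ is: - distance-transitive if, for every $s\ge 0$, $\mathrm{Aut}(D)$ is transitive on the pairs $(u,v)$ of vertices for which there is an $s$-arc from $u$ to $v$ but no $t$-arc with $t<s$; - weakly descendant-homogeneous if $\mathrm{Aut}(D)$ is transitive on vertices and, for any two finite sets $X,Y$ of vertices and any isomorphism $f$ from the induced subdigraph on $\mathrm{desc}(X)$ to the induced subdigraph on $\mathrm{desc}(Y)$, there is an automorphism of $D$ that agrees with $f$ on $X$. The digraph $D$ has property $Z$ if there is a homomorphism from $D$ onto the digraph with vertex set $\mathbb Z$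 and edges $(i,i+1)$, $i\in\mathbb Z$; that is, a surjective map $f\colon D\to\mathbb Z$ with $f(v)=f(u)+1$ for every edge $(u,v)$ of $D$. **Theorem.** Let $D$ be an infinite, connected, locally finite, distance-transitive digraph with no directed cycles. If $D$ is weakly descendant-homogeneous, then $D$ has property $Z$. -/

import Mathlib

namespace Digraph

variable {V : Type*} {W : Type*}

/-- An isomorphism of digraphs: a bijection of the vertex sets such that `(u, v)` is an edge if and
only if its image is an edge. -/
abbrev Iso (D : Digraph V) (D' : Digraph W) := D.Adj ≃r D'.Adj

/-- An automorphism of a digraph. -/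
abbrev Aut (D : Digraph V) := Iso D D

/-- The full induced subdigraph on a set of vertices. -/
def induce (D : Digraph V) (s : Set V) : Digraph s where
  Adj a b := D.Adj a b

/-- A digraph is connected if any two vertices are joined by a path of its underlying undirected
graph (edges may be traversed in both directions). -/
def IsConnected (D : Digraph V) : Prop :=
  D.toSimpleGraphInclusive.Connected

/-- All out-valencies and all in-valencies are finite. -/
def IsLocallyFinite (D : Digraph V) : Prop :=
  ∀ v : V, {u | D.Adj v u}.Finite ∧ {u | D.Adj u v}.Finite

/-- There is an `s`-arc `a 0, a 1, …, a s` from `u` to `v`: consecutive vertices form edges, and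
`a (i - 1) ≠ a (i + 1)` for `0 < i < s`. Only the values `a i` with `i ≤ s` matter. -/
def HasArc (D : Digraph V) (s : ℕ) (u v : V) : Prop :=
  ∃ a : ℕ → V, a 0 = u ∧ a s = v ∧ (∀ i, i < s → D.Adj (a i) (a (i + 1))) ∧
    ∀ i, 0 < i → i < s → a (i - 1) ≠ a (i + 1)

/-- There is an `s`-arc from `u` to `v`, but no `t`-arc for any `t < s`. -/
def IsAtDist (D : Digraph V) (s : ℕ) (u v : V) : Prop :=
  D.HasArc s u v ∧ ∀ t, t < s → ¬ D.HasArc t u v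

/-- For every `s`, the automorphism group is transitive on the pairs `(u, v)` with `v` at directed
distance `s` from `u`. -/
def IsDistanceTransitive (D : Digraph V) : Prop :=
  ∀ (s : ℕ) (u v u' v' : V), D.IsAtDist s u v → D.IsAtDist s u' v' →
    ∃ g : D.Aut, g u = u' ∧ g v = v'

/-- There is no sequence `c 0, c 1, …, c n = c 0` of `n ≥ 1` edges with `c 0, …, c (n - 1)`
distinct. Cycles of length one (loops) and two are included. -/
def HasNoDirectedCycle (D : Digraph V) : Prop :=
  ¬ ∃ (n : ℕ) (c : ℕ → V), 1 ≤ n ∧ c n = c 0 ∧ Set.InjOn c {i | i < n} ∧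
    ∀ i, i < n → D.Adj (c i) (c (i + 1))

/-- The descendant set of a set `X` of vertices: all vertices that can be reached by an `s`-arc,
for some `s ≥ 0`, from some vertex in `X`. -/
def desc (D : Digraph V) (X : Set V) : Set V :=
  {v | ∃ x ∈ X, ∃ s : ℕ, D.HasArc s x v}

theorem subset_desc (D : Digraph V) (X : Set V) : X ⊆ D.desc X :=
  fun x hx => ⟨x, hx, 0, fun _ => x, rfl, rfl, fun i hi => absurd hi (Nat.not_lt_zero i),
    fun i _ hi => absurd hi (Nat.not_lt_zero i)⟩

/-- The automorphism group is transitive on vertices. -/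
def IsVertexTransitive (D : Digraph V) : Prop :=
  ∀ u v : V, ∃ g : D.Aut, g u = v

/-- Vertex transitive, and for all finite sets `X`, `Y` of vertices and every isomorphism `f` from
the induced subdigraph on `desc X` to the induced subdigraph on `desc Y`, some automorphism of the
digraph agrees with `f` on `X`. -/
def IsWeaklyDescendantHomogeneous (D : Digraph V) : Prop :=
  D.IsVertexTransitive ∧
    ∀ X Y : Set V, X.Finite → Y.Finite →
      ∀ f : Iso (D.induce (D.desc X)) (D.induce (D.desc Y)),
        ∃ g : D.Aut, ∀ (x : V) (hx : x ∈ X), g x = (f ⟨x, D.subset_desc X hx⟩ : V)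

/-- There is a homomorphism from the digraph onto the digraph on `ℤ` with edges `(i, i + 1)`. -/
def HasPropertyZ (D : Digraph V) : Prop :=
  ∃ f : V → ℤ, Function.Surjective f ∧ ∀ u v : V, D.Adj u v → f v = f u + 1

end Digraph

namespace Digraph

variable {V : Type*} {D : Digraph V}

/-! Two facts yield the map to ℤ. Distance-transitivity makes all directed walks with the same ends
equally long (`reach_length_unique`), and weak descendant-homogeneity gives any two vertices a
common descendant (`exists_common_descendant`). Each fact is proved by contradiction: its failure
would produce a finite nonempty set in which one can always walk on to another member, which
acyclicity forbids. The level of a vertex relative to a base point is then the difference of the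
walk lengths to a common descendant. -/

/-- There is a directed walk of length `n` from `u` to `v`. -/
def Reach (D : Digraph V) : ℕ → V → V → Prop
  | 0, u, v => u = v
  | n + 1, u, w => ∃ v, D.Reach n u v ∧ D.Adj v w

/-- There is a walk of length `n` from `u` to `v` in the underlying undirected graph. -/
def UReach (D : Digraph V) : ℕ → V → V → Prop
  | 0, u, v => u = v
  | n + 1, u, w => ∃ v, D.UReach n u v ∧ (D.Adj v w ∨ D.Adj w v)

theorem Reach.trans {m n : ℕ} {u v w : V} (h : D.Reach m u v) (h' : D.Reach n v w) :
    D.Reach (m + n) u w := by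
  induction n generalizing w with
  | zero => cases h'; exact h
  | succ n ih => obtain ⟨z, hz, hw⟩ := h'; exact ⟨z, ih hz, hw⟩

theorem reach_one {u v : V} (h : D.Adj u v) : D.Reach 1 u v := ⟨u, rfl, h⟩

theorem Reach.split {m n : ℕ} {u w : V} (h : D.Reach (m + n) u w) :
    ∃ v, D.Reach m u v ∧ D.Reach n v w := by
  induction n generalizing w with
  | zero => exact ⟨w, h, rfl⟩
  | succ n ih =>
    obtain ⟨z, hz, hw⟩ := h
    obtain ⟨v, hv, hvz⟩ := ih hz
    exact ⟨v, hv, z, hvz, hw⟩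

theorem Reach.map (g : D.Aut) {n : ℕ} {u v : V} (h : D.Reach n u v) :
    D.Reach n (g u) (g v) := by
  induction n generalizing v with
  | zero => exact congrArg g h
  | succ n ih => obtain ⟨z, hz, hw⟩ := h; exact ⟨g z, ih hz, g.map_rel_iff.2 hw⟩

theorem UReach.map (g : D.Aut) {n : ℕ} {u v : V} (h : D.UReach n u v) :
    D.UReach n (g u) (g v) := by
  induction n generalizing v with
  | zero => exact congrArg g h
  | succ n ih =>
    obtain ⟨z, hz, hw⟩ := h
    exact ⟨g z, ih hz, hw.imp g.map_rel_iff.2 g.map_rel_iff.2⟩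

theorem Reach.exists_seq {n : ℕ} {u v : V} (h : D.Reach n u v) :
    ∃ c : ℕ → V, c 0 = u ∧ c n = v ∧ ∀ i, i < n → D.Adj (c i) (c (i + 1)) := by
  induction n generalizing v with
  | zero => exact ⟨fun _ => u, rfl, h, by simp⟩
  | succ n ih =>
    obtain ⟨z, hz, hw⟩ := h
    obtain ⟨c, h0, hn, hc⟩ := ih hz
    refine ⟨fun i => if i ≤ n then c i else v, by simpa using h0, by simp, fun i hi => ?_⟩
    rcases Nat.lt_succ_iff_lt_or_eq.1 hi with hi | rfl
    · have h1 : i ≤ n := hi.le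
      have h2 : i + 1 ≤ n := hi
      simpa [h1, h2] using hc i hi
    · simpa [hn] using hw

theorem reach_of_seq {n : ℕ} (c : ℕ → V) (hc : ∀ i, i < n → D.Adj (c i) (c (i + 1)))
    {i k : ℕ} (h : i + k ≤ n) : D.Reach k (c i) (c (i + k)) := by
  induction k with
  | zero => exact rfl
  | succ k ih => exact ⟨_, ih (by omega), hc _ (by omega)⟩

/-- A repeated vertex cuts out a shorter closed walk, so a shortest closed walk is a directed cycle.
-/
theorem HasNoDirectedCycle.not_reach_self (hcyc : D.HasNoDirectedCycle) {n : ℕ} (hn : 1 ≤ n)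
    (u : V) : ¬ D.Reach n u u := by
  induction n using Nat.strong_induction_on generalizing u with
  | _ n ih =>
    intro h
    obtain ⟨c, h0, hcn, hc⟩ := h.exists_seq
    have key : ∀ i j, i < j → j < n → c i ≠ c j := fun i j hij hj he => by
      have := reach_of_seq c hc (i := i) (k := j - i) (by omega)
      rw [Nat.add_sub_cancel' hij.le, ← he] at this
      exact ih (j - i) (by omega) (by omega) _ this
    refine hcyc ⟨n, c, hn, hcn.trans h0.symm, fun i hi j hj he => ?_, hc⟩
    rcases lt_trichotomy i j with hij | hij | hij
    · exact absurd he (key i j hij hj)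
    · exact hij
    · exact absurd he.symm (key j i hij hi)

/-- Backtracking would be a closed walk of length two, so the extra condition on arcs is automatic.
-/
theorem HasNoDirectedCycle.hasArc_iff (hcyc : D.HasNoDirectedCycle) {n : ℕ} {u v : V} :
    D.HasArc n u v ↔ D.Reach n u v := by
  constructor
  · rintro ⟨a, rfl, rfl, ha, -⟩
    simpa using reach_of_seq a ha (i := 0) (k := n) (by omega)
  · intro h
    obtain ⟨c, h0, hn, hc⟩ := h.exists_seq
    refine ⟨c, h0, hn, hc, fun i hi hin he => ?_⟩
    have := reach_of_seq c hc (i := i - 1) (k := 2) (by omega)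
    rw [show i - 1 + 2 = i + 1 by omega, ← he] at this
    exact hcyc.not_reach_self (by norm_num) _ this

theorem HasNoDirectedCycle.isAtDist_iff (hcyc : D.HasNoDirectedCycle) {n : ℕ} {u v : V} :
    D.IsAtDist n u v ↔ D.Reach n u v ∧ ∀ t, t < n → ¬ D.Reach t u v := by
  simp only [IsAtDist, hcyc.hasArc_iff]

theorem HasNoDirectedCycle.mem_desc_iff (hcyc : D.HasNoDirectedCycle) {X : Set V} {v : V} :
    v ∈ D.desc X ↔ ∃ x ∈ X, ∃ n, D.Reach n x v := by
  simp only [desc, hcyc.hasArc_iff, Set.mem_ofPred_eq]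

theorem IsLocallyFinite.finite_uReach (hfin : D.IsLocallyFinite) (n : ℕ) (u : V) :
    {v | D.UReach n u v}.Finite := by
  induction n with
  | zero => exact (Set.finite_singleton u).subset fun v hv => Eq.symm hv
  | succ n ih =>
    refine (ih.biUnion fun v _ => (hfin v).1.union (hfin v).2).subset ?_
    rintro w ⟨v, hv, hw⟩
    exact Set.mem_biUnion hv hw

theorem Reach.uReach {n : ℕ} {u v : V} (h : D.Reach n u v) : D.UReach n u v := by
  induction n generalizing v with
  | zero => exact h
  | succ n ih => obtain ⟨z, hz, hw⟩ := h; exact ⟨z, ih hz, Or.inl hw⟩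

theorem IsConnected.exists_uReach (hconn : D.IsConnected) (u v : V) : ∃ n, D.UReach n u v := by
  have h := hconn.preconnected u v
  rw [SimpleGraph.reachable_iff_reflTransGen] at h
  induction h with
  | refl => exact ⟨0, rfl⟩
  | tail _ hw ih =>
    obtain ⟨n, hn⟩ := ih
    refine ⟨n + 1, _, hn, ?_⟩
    simpa [Digraph.toSimpleGraphInclusive] using hw.2

/-- In an acyclic digraph, no nonempty finite set of vertices has the property that from each of
its vertices one can walk to another one. -/
theorem HasNoDirectedCycle.eq_empty_of_forall_reach (hcyc : D.HasNoDirectedCycle) {S : Set V}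
    (hS : S.Finite) (h : ∀ x ∈ S, ∃ y ∈ S, ∃ n, 1 ≤ n ∧ D.Reach n x y) : S = ∅ := by
  by_contra hne
  have : Finite S := hS
  let r : S → S → Prop := fun y x => ∃ n, 1 ≤ n ∧ D.Reach n (x : V) y
  have : IsTrans S r := ⟨fun a b c ⟨m, hm, h1⟩ ⟨n, _, h2⟩ => ⟨n + m, by omega, h2.trans h1⟩⟩
  have : Std.Irrefl r := ⟨fun a ⟨n, hn, h1⟩ => hcyc.not_reach_self hn _ h1⟩
  have hwf : WellFounded r := Finite.wellFounded_of_trans_of_irrefl r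
  obtain ⟨x, hx⟩ := Set.nonempty_iff_ne_empty.2 hne
  obtain ⟨m, -, hm⟩ := hwf.has_min Set.univ ⟨⟨x, hx⟩, trivial⟩
  obtain ⟨y, hy, hr⟩ := h m m.2
  exact hm ⟨y, hy⟩ trivial hr

/-- If the edge to `y` did not lead outward, `y` would be at some distance `j ≤ n`, like the vertex
`z` on a shortest walk to `x`. As `x` is reachable from `z`, symmetry lets one walk from `y` back
into the sphere of radius `n`, and likewise from every vertex of that finite sphere. -/
theorem IsDistanceTransitive.isAtDist_succ (hdist : D.IsDistanceTransitive)
    (hcyc : D.HasNoDirectedCycle) (hfin : D.IsLocallyFinite) {n : ℕ} {u x y : V}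
    (hx : D.IsAtDist n u x) (hxy : D.Adj x y) : D.IsAtDist (n + 1) u y := by
  classical
  have hx' := hcyc.isAtDist_iff.1 hx
  refine hcyc.isAtDist_iff.2 ⟨⟨x, hx'.1, hxy⟩, ?_⟩
  by_contra! hlt
  have hex : ∃ t, D.Reach t u y := hlt.imp fun t ht => ht.2
  obtain ⟨j, hj, hyj⟩ : ∃ j ≤ n, D.IsAtDist j u y := by
    obtain ⟨t, ht, hty⟩ := hlt
    exact ⟨Nat.find hex, (Nat.find_min' hex hty).trans (by omega),
      hcyc.isAtDist_iff.2 ⟨Nat.find_spec hex, fun t ht => Nat.find_min hex ht⟩⟩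
  obtain ⟨i, rfl⟩ := Nat.exists_eq_add_of_le hj
  obtain ⟨z, huz, hzx⟩ := hx'.1.split
  have hz : D.IsAtDist j u z := hcyc.isAtDist_iff.2
    ⟨huz, fun t ht h => hx'.2 (t + i) (by omega) (h.trans hzx)⟩
  have hempty := hcyc.eq_empty_of_forall_reach (S := {w | D.IsAtDist (j + i) u w})
    ((hfin.finite_uReach (j + i) u).subset fun w hw => (hcyc.isAtDist_iff.1 hw).1.uReach) ?_
  · exact (Set.eq_empty_iff_forall_notMem.1 hempty) x hx
  intro w hw
  obtain ⟨g, hgu, hgw⟩ := hdist _ _ _ _ _ hx hw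
  -- Both `z` and `g y` are at distance `j` from `u`, so the walk from `z` to `x` can be
  -- transplanted to start at `g y`.
  obtain ⟨g', hgu', hgz'⟩ := hdist j u z u (g y) hz (by
    have h := hcyc.isAtDist_iff.1 hyj
    refine hcyc.isAtDist_iff.2 ⟨hgu ▸ h.1.map g, fun t ht h' => h.2 t ht ?_⟩
    have := h'.map g.symm
    rwa [← hgu, RelIso.symm_apply_apply, RelIso.symm_apply_apply] at this)
  refine ⟨g' x, ?_, 1 + i, by omega, ?_⟩
  · refine hcyc.isAtDist_iff.2 ⟨hgu' ▸ hx'.1.map g', fun t ht h' => hx'.2 t ht ?_⟩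
    have := h'.map g'.symm
    rwa [← hgu', RelIso.symm_apply_apply, RelIso.symm_apply_apply] at this
  · have h1 : D.Reach 1 w (g y) := hgw ▸ (reach_one hxy).map g
    exact h1.trans (hgz' ▸ hzx.map g')

theorem IsDistanceTransitive.reach_length_unique (hdist : D.IsDistanceTransitive)
    (hcyc : D.HasNoDirectedCycle) (hfin : D.IsLocallyFinite) {m n : ℕ} {u v : V}
    (hm : D.Reach m u v) (hn : D.Reach n u v) : m = n := by
  have key : ∀ {k : ℕ} {w : V}, D.Reach k u w → D.IsAtDist k u w := by
    intro k
    induction k with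
    | zero => exact fun h => hcyc.isAtDist_iff.2 ⟨h, by simp⟩
    | succ k ih =>
      rintro w ⟨z, hz, hzw⟩
      exact hdist.isAtDist_succ hcyc hfin (ih hz) hzw
  have h1 := (hcyc.isAtDist_iff.1 (key hm)).2 n
  have h2 := (hcyc.isAtDist_iff.1 (key hn)).2 m
  rcases lt_trichotomy m n with h | h | h
  · exact absurd hm (h2 h)
  · exact h
  · exact absurd hn (h1 h)

/-- Two vertices are descendant-disjoint if they have no common descendant. -/
def DescDisjoint (D : Digraph V) (x y : V) : Prop :=
  ∀ w m n, D.Reach m x w → ¬ D.Reach n y w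

/-- No edge joins the descendants of `x` to those of `y`, since its head would be common to both. So
an automorphism taking `x` to `x'` glues with the identity on the descendants of `y`. -/
theorem IsWeaklyDescendantHomogeneous.exists_aut_of_descDisjoint
    (hwdh : D.IsWeaklyDescendantHomogeneous) (hcyc : D.HasNoDirectedCycle) {x x' y : V}
    (h : D.DescDisjoint x y) (h' : D.DescDisjoint x' y) :
    ∃ g : D.Aut, g x = x' ∧ g y = y := by
  classical
  obtain ⟨g, hg⟩ := hwdh.1 x x'
  have hmap : ∀ a, (∃ n, D.Reach n x' (g a)) ↔ ∃ n, D.Reach n x a := fun a => by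
    refine exists_congr fun n => ⟨fun ha => ?_, fun ha => hg ▸ ha.map g⟩
    have := ha.map g.symm
    rwa [← hg, RelIso.symm_apply_apply, RelIso.symm_apply_apply] at this
  have hmem : ∀ {z a : V}, a ∈ D.desc {z, y} ↔ (∃ n, D.Reach n z a) ∨ ∃ n, D.Reach n y a := by
    intro z a
    simp [hcyc.mem_desc_iff]
  have hdis : ∀ {z a : V}, D.DescDisjoint z y → (∃ n, D.Reach n y a) → ¬ ∃ n, D.Reach n z a :=
    fun hz ⟨n, hn⟩ ⟨m, hm⟩ => hz _ _ _ hm hn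
  have hout : ∀ {z a b : V}, (∃ n, D.Reach n z a) → D.Adj a b → ∃ n, D.Reach n z b :=
    fun ⟨n, hn⟩ hab => ⟨n + 1, _, hn, hab⟩
  let F : V → V := fun a => if ∃ n, D.Reach n x a then g a else a
  let G : V → V := fun a => if ∃ n, D.Reach n x' a then g.symm a else a
  have F1 : ∀ {a}, (∃ n, D.Reach n x a) → F a = g a := fun ha => if_pos ha
  have F2 : ∀ {a}, (∃ n, D.Reach n y a) → F a = a := fun ha => if_neg (hdis h ha)
  have G1 : ∀ {a}, (∃ n, D.Reach n x' a) → G a = g.symm a := fun ha => if_pos ha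
  have G2 : ∀ {a}, (∃ n, D.Reach n y a) → G a = a := fun ha => if_neg (hdis h' ha)
  have hmap' : ∀ {a}, (∃ n, D.Reach n x' a) → ∃ n, D.Reach n x (g.symm a) := fun {a} ha =>
    (hmap _).1 (by rwa [RelIso.apply_symm_apply])
  let f : Iso (D.induce (D.desc {x, y})) (D.induce (D.desc {x', y})) :=
    { toFun := fun a => ⟨F a, by
        rcases hmem.1 a.2 with ha | ha
        · rw [F1 ha]; exact hmem.2 (Or.inl ((hmap _).2 ha))
        · rw [F2 ha]; exact hmem.2 (Or.inr ha)⟩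
      invFun := fun a => ⟨G a, by
        rcases hmem.1 a.2 with ha | ha
        · rw [G1 ha]; exact hmem.2 (Or.inl (hmap' ha))
        · rw [G2 ha]; exact hmem.2 (Or.inr ha)⟩
      left_inv := fun a => Subtype.ext <| by
        change G (F a) = a
        rcases hmem.1 a.2 with ha | ha
        · rw [F1 ha, G1 ((hmap _).2 ha), RelIso.symm_apply_apply]
        · rw [F2 ha, G2 ha]
      right_inv := fun a => Subtype.ext <| by
        change F (G a) = a
        rcases hmem.1 a.2 with ha | ha
        · rw [G1 ha, F1 (hmap' ha), RelIso.apply_symm_apply]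
        · rw [G2 ha, F2 ha]
      map_rel_iff' := fun {a b} => by
        change D.Adj (F a) (F b) ↔ D.Adj a b
        rcases hmem.1 a.2 with ha | ha <;> rcases hmem.1 b.2 with hb | hb
        · rw [F1 ha, F1 hb]; exact g.map_rel_iff
        · rw [F1 ha, F2 hb]
          exact ⟨fun hab => absurd (hout ((hmap _).2 ha) hab) (hdis h' hb),
            fun hab => absurd (hout ha hab) (hdis h hb)⟩
        · rw [F2 ha, F1 hb]
          exact ⟨fun hab => absurd ((hmap _).2 hb) (hdis h' (hout ha hab)),
            fun hab => absurd hb (hdis h (hout ha hab))⟩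
        · rw [F2 ha, F2 hb] }
  obtain ⟨k, hk⟩ := hwdh.2 {x, y} {x', y} (by simp) (by simp) f
  refine ⟨k, (hk x (by simp)).trans ((F1 ⟨0, rfl⟩).trans hg), (hk y (by simp)).trans (F2 ⟨0, rfl⟩)⟩

/-- Any two vertices have a common descendant. -/
theorem IsWeaklyDescendantHomogeneous.exists_common_descendant
    (hwdh : D.IsWeaklyDescendantHomogeneous) (hconn : D.IsConnected) (hfin : D.IsLocallyFinite)
    (hcyc : D.HasNoDirectedCycle) (hout : ∀ u, ∃ v, D.Adj u v) (x y : V) :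
    ∃ w m n, D.Reach m x w ∧ D.Reach n y w := by
  by_contra! h
  obtain ⟨d, hd⟩ := hconn.exists_uReach y x
  have hempty := hcyc.eq_empty_of_forall_reach (S := {w | ∃ n, D.Reach n x w})
    ((hfin.finite_uReach d y).subset ?_) ?_
  · exact (Set.eq_empty_iff_forall_notMem.1 hempty) x ⟨0, rfl⟩
  · rintro w ⟨n, hn⟩
    -- Fixing `y` and moving `x` to its descendant `w` puts all descendants of `x` within the finite
    -- ball of undirected radius `d` about `y`.
    obtain ⟨g, hgx, hgy⟩ := hwdh.exists_aut_of_descDisjoint hcyc (x := x) (x' := w) (y := y) h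
      fun z i j hi => h z (n + i) j (hn.trans hi)
    have := hd.map g
    rwa [hgx, hgy] at this
  · rintro w ⟨n, hn⟩
    obtain ⟨v, hv⟩ := hout w
    exact ⟨v, ⟨n + 1, w, hn, hv⟩, 1, le_rfl, reach_one hv⟩

theorem IsConnected.exists_adj [Infinite V] (hconn : D.IsConnected) : ∃ u v, D.Adj u v := by
  obtain ⟨u, v, huv⟩ := exists_pair_ne V
  obtain ⟨n, hn⟩ := hconn.exists_uReach u v
  cases n with
  | zero => exact absurd hn huv
  | succ n =>
    obtain ⟨z, -, hz | hz⟩ := hn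
    exacts [⟨_, _, hz⟩, ⟨_, _, hz⟩]

/-- If every vertex has an in-neighbour and an out-neighbour, then a map to `ℤ` that increases by
one along every edge is surjective. -/
theorem surjective_of_adj_add_one [Nonempty V] (f : V → ℤ)
    (hf : ∀ u v, D.Adj u v → f v = f u + 1) (hout : ∀ u, ∃ v, D.Adj u v)
    (hin : ∀ v, ∃ u, D.Adj u v) : Function.Surjective f := by
  obtain ⟨x⟩ := ‹Nonempty V›
  intro z
  induction z using Int.inductionOn' (b := f x) with
  | zero => exact ⟨x, rfl⟩
  | succ k _ ih =>
    obtain ⟨u, rfl⟩ := ih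
    obtain ⟨v, hv⟩ := hout u
    exact ⟨v, hf u v hv⟩
  | pred k _ ih =>
    obtain ⟨v, rfl⟩ := ih
    obtain ⟨u, hu⟩ := hin v
    exact ⟨u, by rw [hf u v hu]; ring⟩

/-- If walks with the same ends have the same length and any two vertices have a common descendant,
then comparing lengths of walks to common descendants grades the digraph by the integers. -/
theorem exists_grading [Nonempty V]
    (huniq : ∀ {m n : ℕ} {u v : V}, D.Reach m u v → D.Reach n u v → m = n)
    (hcommon : ∀ x y, ∃ w m n, D.Reach m x w ∧ D.Reach n y w) :
    ∃ f : V → ℤ, ∀ u v, D.Adj u v → f v = f u + 1 := by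
  obtain ⟨x⟩ := ‹Nonempty V›
  choose w m n hm hn using hcommon x
  refine ⟨fun v => (m v : ℤ) - n v, fun u v huv => ?_⟩
  -- Extending all walks to a common `z` makes the two differences comparable.
  obtain ⟨z, i, j, hi, hj⟩ := hcommon (w u) (w v)
  have h1 := huniq ((hm u).trans hi) ((hm v).trans hj)
  have h2 := huniq ((hn u).trans hi) ((reach_one huv).trans ((hn v).trans hj))
  dsimp only
  omega

end Digraph

theorem theorem1p2 {V : Type*} [Infinite V] (D : Digraph V)
    (hconn : D.IsConnected)
    (hfin : D.IsLocallyFinite)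
    (hdist : D.IsDistanceTransitive)
    (hcyc : D.HasNoDirectedCycle)
    (hwdh : D.IsWeaklyDescendantHomogeneous) :
    D.HasPropertyZ := by
  obtain ⟨a, b, hab⟩ := hconn.exists_adj
  have hout : ∀ u, ∃ v, D.Adj u v := fun u => by
    obtain ⟨g, rfl⟩ := hwdh.1 a u
    exact ⟨g b, g.map_rel_iff.2 hab⟩
  have hin : ∀ v, ∃ u, D.Adj u v := fun v => by
    obtain ⟨g, rfl⟩ := hwdh.1 b v
    exact ⟨g a, g.map_rel_iff.2 hab⟩
  obtain ⟨f, hf⟩ := Digraph.exists_grading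
    (fun h h' => hdist.reach_length_unique hcyc hfin h h')
    (hwdh.exists_common_descendant hconn hfin hcyc hout)
  exact ⟨f, Digraph.surjective_of_adj_add_one f hf hout hin, hf⟩
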